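/- Let $d\in\mathbb N$, $d>1$, let $1\le p,q\le\infty$ and $r>0$. Fix any non-negative $\varphi_0\in C_0^\infty(\mathbb R)$ with $\varphi_0=1$ on $[-1,1]$ and $\operatorname{supp}\varphi_0\subset[-\tfrac32,\tfrac32]$. Put $\varphi_j(\xi)=\varphi_0(2^{-j}\xi)-\varphi_0(2^{-j+1}\xi)$ for $j\in\mathbb N$, and $\varphi_k(\xi)=\varphi_{k_1}(\xi_1)\cdots\varphi_{k_d}(\xi_d)$ for $k\in\mathbb N_0^d$; write $|k|_1=k_1+\dots+k_d$. With $\mathcal F\varphi(\xi)=(2\pi)^{-d/2}\int_{\mathbb R^d}e^{-ix\cdot\xi}\varphi(x)\,dx$, extended to tempered distributions, let $S^r_{p,q}B(\mathbb R^d)$ be the space of all $u\in\mathcal S'(\mathbb R^d)$ with $$\|u\,|\,S^r_{p,q}B(\mathbb R^d)\|=\Big(\sum_{k\in\mathbb N_0^d}2^{r|k|_1q}\,\|\mathcal F^{-1}[\varphi_k\mathcal F u]\,|\,L_p(\mathbb R^d)\|^q\Big)^{1/q}<\infty$$ (supremum over $k$ if $q=\infty$). For $\Omega=[0,1]^d$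 let $S^r_{p,q}B(\Omega)$ be the space of all distributions $f$ on $\Omega$ (that is, on the interior $(0,1)^d$, with complex values) that are restrictions $f=g|_\Omega$ of some $g\in S^r_{p,q}B(\mathbb R^d)$, with the norm $$\|f\,|\,S^r_{p,q}B(\Omega)\|=\inf\{\|g\,|\,S^r_{p,q}B(\mathbb R^d)\| : g|_\Omega=f\}$$ ($=\infty$ if there is no such $g$). Then there is no constant $C>0$ such that $$\|f\cdot g\,|\,S^r_{p,q}B(\Omega)\|\le C\big(\|f\,|\,S^r_{p,q}B(\Omega)\|\,\|g\,|\,L_\infty(\Omega)\|+\|f\,|\,L_\infty(\Omega)\|\,\|g\,|\,S^r_{p,q}B(\Omega)\|\big)$$ holds for all $f,g\in S^r_{p,q}B(\Omega)\cap L_\infty(\Omega)$. -/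

import Mathlib

open MeasureTheory
open scoped ENNReal NNReal SchwartzMap Distributions

namespace DominatingMixed

noncomputable section

/-- A generator of a smooth dyadic decomposition of unity: a non-negative `C_0^∞` function on the
line, equal to `1` on `[-1, 1]` and supported in `[-3/2, 3/2]`. -/
structure IsGenerator (φ₀ : ℝ → ℝ) : Prop where
  contDiff : ContDiff ℝ ((⊤ : ℕ∞) : WithTop ℕ∞) φ₀
  nonneg : ∀ t, 0 ≤ φ₀ t
  eq_one : ∀ t ∈ Set.Icc (-1 : ℝ) 1, φ₀ t = 1
  tsupport_subset : tsupport φ₀ ⊆ Set.Icc (-(3 / 2) : ℝ) (3 / 2)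

/-- The dyadic functions on the line: `φ_0`, and `φ_j(ξ) = φ_0(2^{-j} ξ) - φ_0(2^{-j+1} ξ)` for
`j ≥ 1`. -/
def dyadic (φ₀ : ℝ → ℝ) : ℕ → ℝ → ℝ
  | 0, ξ => φ₀ ξ
  | j + 1, ξ => φ₀ (ξ / 2 ^ (j + 1)) - φ₀ (ξ / 2 ^ j)

/-- The tensor product functions `φ_k(ξ) = φ_{k_1}(ξ_1) ⋯ φ_{k_d}(ξ_d)`. -/
def dyadicTensor {d : ℕ} (φ₀ : ℝ → ℝ) (k : Fin d → ℕ) (ξ : EuclideanSpace ℝ (Fin d)) : ℝ :=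
  ∏ i, dyadic φ₀ (k i) (ξ i)

/-- The operator `u ↦ F⁻¹[φ_k F u]` on tempered distributions, where `F` is the Fourier transform
with kernel `(2π)^{-d/2} e^{-i x·ξ}`. Mathlib's transform has the kernel `e^{-2πi x·η}`; since
`ξ = 2π η`, the symbol is `η ↦ φ_k(2π η)` there. -/
def dyadicBlock {d : ℕ} (φ₀ : ℝ → ℝ) (k : Fin d → ℕ) :
    𝓢'(EuclideanSpace ℝ (Fin d), ℂ) →L[ℂ] 𝓢'(EuclideanSpace ℝ (Fin d), ℂ) :=
  TemperedDistribution.fourierMultiplierCLM ℂ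
    (fun η => (dyadicTensor φ₀ k ((2 * Real.pi) • η) : ℂ))

/-- The `L_p(ℝ^d)` norm of a tempered distribution: the norm of the (unique) `L_p` function that
represents it, and `∞` if there is none. -/
def lpNorm {d : ℕ} (p : ℝ≥0∞) [Fact (1 ≤ p)] (u : 𝓢'(EuclideanSpace ℝ (Fin d), ℂ)) : ℝ≥0∞ :=
  ⨅ (h : Lp ℂ p (volume : Measure (EuclideanSpace ℝ (Fin d))))
    (_ : Lp.toTemperedDistribution h = u), ‖h‖ₑ

/-- The (extended) norm of `S^r_{p,q}B(ℝ^d)`. A tempered distribution belongs to the space if and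
only if this is finite. -/
def besovNorm {d : ℕ} (φ₀ : ℝ → ℝ) (p q : ℝ≥0∞) [Fact (1 ≤ p)] (r : ℝ)
    (u : 𝓢'(EuclideanSpace ℝ (Fin d), ℂ)) : ℝ≥0∞ :=
  if q = ∞ then
    ⨆ k : Fin d → ℕ, (2 : ℝ≥0∞) ^ (r * ((∑ i, k i : ℕ) : ℝ)) * lpNorm p (dyadicBlock φ₀ k u)
  else
    (∑' k : Fin d → ℕ,
      ((2 : ℝ≥0∞) ^ (r * ((∑ i, k i : ℕ) : ℝ)) * lpNorm p (dyadicBlock φ₀ k u)) ^ q.toReal)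
        ^ (1 / q.toReal)

/-- The cube `[0,1]^d`. -/
def cube (d : ℕ) : Set (EuclideanSpace ℝ (Fin d)) :=
  {x | ∀ i, x i ∈ Set.Icc (0 : ℝ) 1}

/-- The interior `(0,1)^d` of the cube, on which distributions on the cube live. -/
def openCube (d : ℕ) : TopologicalSpace.Opens (EuclideanSpace ℝ (Fin d)) where
  carrier := {x | ∀ i, x i ∈ Set.Ioo (0 : ℝ) 1}
  is_open' := by
    have h : {x : EuclideanSpace ℝ (Fin d) | ∀ i, x i ∈ Set.Ioo (0 : ℝ) 1} =
        ⋂ i, (fun x : EuclideanSpace ℝ (Fin d) => x i) ⁻¹' Set.Ioo (0 : ℝ) 1 := by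
      ext x; simp
    rw [h]
    exact isOpen_iInter_of_finite fun i => isOpen_Ioo.preimage (by fun_prop)

/-- Complex distributions on the cube: continuous linear forms on `C_0^∞((0,1)^d)`. -/
abbrev CubeDistribution (d : ℕ) : Type :=
  𝓓(openCube d, ℂ) →L[ℂ] ℂ

/-- A test function on the cube, extended by zero, as a Schwartz function. -/
def testToSchwartz {d : ℕ} (φ : 𝓓(openCube d, ℂ)) : 𝓢(EuclideanSpace ℝ (Fin d), ℂ) :=
  φ.hasCompactSupport.toSchwartzMap φ.contDiff

/-- `G|_Ω = u` for a tempered distribution `G` and a distribution `u` on the cube `Ω`. -/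
def RestrictsTo {d : ℕ} (G : 𝓢'(EuclideanSpace ℝ (Fin d), ℂ)) (u : CubeDistribution d) : Prop :=
  ∀ φ : 𝓓(openCube d, ℂ), G (testToSchwartz φ) = u φ

/-- The (extended) quotient norm of `S^r_{p,q}B(Ω)`, `Ω = [0,1]^d`. -/
def besovNormCube {d : ℕ} (φ₀ : ℝ → ℝ) (p q : ℝ≥0∞) [Fact (1 ≤ p)] (r : ℝ)
    (u : CubeDistribution d) : ℝ≥0∞ :=
  ⨅ (G : 𝓢'(EuclideanSpace ℝ (Fin d), ℂ)) (_ : RestrictsTo G u), besovNorm φ₀ p q r G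

/-- Membership in `S^r_{p,q}B(Ω)`, `Ω = [0,1]^d`: the distribution is the restriction of an element
of `S^r_{p,q}B(ℝ^d)`. -/
def MemBesovCube {d : ℕ} (φ₀ : ℝ → ℝ) (p q : ℝ≥0∞) [Fact (1 ≤ p)] (r : ℝ)
    (u : CubeDistribution d) : Prop :=
  ∃ G : 𝓢'(EuclideanSpace ℝ (Fin d), ℂ), besovNorm φ₀ p q r G < ∞ ∧ RestrictsTo G u

/-- The regular distribution `φ ↦ ∫ φ f` on the cube, for `f` locally integrable there. -/
def regularDistribution {d : ℕ} (f : EuclideanSpace ℝ (Fin d) → ℂ) : CubeDistribution d :=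
  TestFunction.integralAgainstBilinCLM (ContinuousLinearMap.mul ℂ ℂ) volume f

/-- Membership of a function in `S^r_{p,q}B(Ω) ∩ L_∞(Ω)`, `Ω = [0,1]^d`. -/
def MemBesovCubeInter {d : ℕ} (φ₀ : ℝ → ℝ) (p q : ℝ≥0∞) [Fact (1 ≤ p)] (r : ℝ)
    (f : EuclideanSpace ℝ (Fin d) → ℂ) : Prop :=
  MemLp f ∞ (volume.restrict (cube d)) ∧ MemBesovCube φ₀ p q r (regularDistribution f)

end

end DominatingMixed

/-! Take a fixed function with narrow frequency support and modulate it to frequency about `2^j` in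
two different coordinate directions. Each wave lives in the single block `k = j e_i`, so its norm is
at most a constant times `2^(rj)` (`besovNorm_wave_le`), while its modulus does not depend on `j`.
The right side of the inequality is therefore `O(2^(rj))`. The product oscillates at frequency about
`2^j` in both directions at once, so `|k|₁` is about `2j`, and dominating mixed smoothness charges
this far more.

The lower bound must hold for every extension `G` of the product from the cube, which calls for
duality. A test function in the open cube carrying the opposite phase pairs with the product to a
nonzero constant independent of `j`. On the other hand `G` splits into its dyadic blocks
(`tendsto_sum_dyadicBlock`), each block is paired by Hölder (`enorm_apply_le_lpNorm_mul`), and a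
low-pass filter of level `k` sees little of the test function unless `|k|₁` is nearly `2j`
(`exists_norm_fatSymbol_le`). Summation bounds the pairing by `C 2^(-3rj/2)` times the norm of `G`
(`exists_enorm_apply_le_besovNorm`). The resulting growth `2^(3rj/2)` is not sharp but already beats
`2^(rj)`. -/

namespace DominatingMixed

open FourierTransform Filter Topology

/-! ### Rapid decay of Schwartz functions cut off away from the origin. -/

section Multipliers

variable {E : Type*} [NormedAddCommGroup E] [NormedSpace ℝ E]

/-- Multiplying a Schwartz function by symbols with uniformly bounded derivatives that vanish on
the ball of radius `R` gives seminorms which decay in `R` faster than any power. -/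
theorem exists_pow_mul_seminorm_smulLeftCLM_le (g : 𝓢(E, ℂ)) (B : ℕ → ℝ) (k n N : ℕ) :
    ∃ C : ℝ, 0 ≤ C ∧ ∀ M : E → ℂ, M.HasTemperateGrowth →
      (∀ m x, ‖iteratedFDeriv ℝ m M x‖ ≤ B m) → ∀ R : ℝ, 0 ≤ R → (∀ x, ‖x‖ < R → M x = 0) →
      R ^ N * SchwartzMap.seminorm ℂ k n (SchwartzMap.smulLeftCLM ℂ M g) ≤ C := by
  set C : ℝ := ∑ i ∈ Finset.range (n + 1), (n.choose i : ℝ) * |B i| *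
    SchwartzMap.seminorm ℂ (k + N) (n - i) g with hC
  have hC0 : 0 ≤ C := Finset.sum_nonneg fun i _ => by positivity
  refine ⟨C, hC0, fun M hM hB R hR hvan => ?_⟩
  rcases eq_or_lt_of_le (pow_nonneg hR N) with h0 | hpos
  · rw [← h0, zero_mul]; exact hC0
  rw [mul_comm, ← le_div_iff₀ hpos]
  refine SchwartzMap.seminorm_le_bound ℂ k n _ (by positivity) fun x => ?_
  rw [le_div_iff₀ hpos]
  have hfun : (⇑(SchwartzMap.smulLeftCLM ℂ M g) : E → ℂ) = fun y => M y • g y := by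
    ext y; simp [hM]
  rw [hfun]
  by_cases hx : ‖x‖ < R
  · have hev : (fun y => M y • g y) =ᶠ[𝓝 x] fun _ => 0 := by
      have : {y : E | ‖y‖ < R} ∈ 𝓝 x := (isOpen_lt continuous_norm continuous_const).mem_nhds hx
      filter_upwards [this] with y hy
      simp [hvan y hy]
    rw [(hev.iteratedFDeriv ℝ n).eq_of_nhds]
    simpa [iteratedFDeriv_fun_zero] using hC0
  -- Here `R ^ N ≤ ‖x‖ ^ N`, and this power is absorbed into the seminorms of `g` with weight `k +
  -- N`. The symbol enters only through the bounds `B`.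
  · push Not at hx
    have h1 := norm_iteratedFDeriv_smul_le (N := ((⊤ : ℕ∞) : WithTop ℕ∞)) hM.1 (g.smooth ⊤) x
      (n := n) (mod_cast le_top)
    calc ‖x‖ ^ k * ‖iteratedFDeriv ℝ n (fun y => M y • g y) x‖ * R ^ N
        ≤ ‖x‖ ^ k * (∑ i ∈ Finset.range (n + 1), (n.choose i : ℝ) *
            ‖iteratedFDeriv ℝ i M x‖ * ‖iteratedFDeriv ℝ (n - i) g x‖) * ‖x‖ ^ N := by gcongr
      _ = ∑ i ∈ Finset.range (n + 1), (n.choose i : ℝ) * ‖iteratedFDeriv ℝ i M x‖ *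
            (‖x‖ ^ (k + N) * ‖iteratedFDeriv ℝ (n - i) g x‖) := by
          rw [Finset.mul_sum, Finset.sum_mul]
          exact Finset.sum_congr rfl fun i _ => by ring
      _ ≤ C := by
          refine Finset.sum_le_sum fun i _ => ?_
          gcongr
          · exact (hB i x).trans (le_abs_self _)
          · exact SchwartzMap.le_seminorm ℂ _ _ g x

/-- Continuity of `T` dominates its norm by finitely many Schwartz seminorms. It serves for `T` the
Fourier transform followed either by a tempered distribution or by the embedding into an `L_p`
space. -/
theorem exists_pow_mul_norm_smulLeftCLM_le {F : Type*} [NormedAddCommGroup F] [NormedSpace ℂ F]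
    (T : 𝓢(E, ℂ) →L[ℂ] F) (g : 𝓢(E, ℂ)) (B : ℕ → ℝ) (N : ℕ) :
    ∃ C : ℝ, 0 ≤ C ∧ ∀ M : E → ℂ, M.HasTemperateGrowth →
      (∀ m x, ‖iteratedFDeriv ℝ m M x‖ ≤ B m) → ∀ R : ℝ, 0 ≤ R → (∀ x, ‖x‖ < R → M x = 0) →
      R ^ N * ‖T (SchwartzMap.smulLeftCLM ℂ M g)‖ ≤ C := by
  obtain ⟨s, A, -, hA⟩ := Seminorm.bound_of_continuous (schwartz_withSeminorms ℂ E ℂ)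
    ((normSeminorm ℂ F).comp T.toLinearMap) (continuous_norm.comp T.continuous)
  choose C hC0 hC using fun i : ℕ × ℕ => exists_pow_mul_seminorm_smulLeftCLM_le g B i.1 i.2 N
  refine ⟨A * ∑ i ∈ s, C i, mul_nonneg A.2 (Finset.sum_nonneg fun i _ => hC0 i),
    fun M hM hB R hR hvan => ?_⟩
  have h1 : ‖T (SchwartzMap.smulLeftCLM ℂ M g)‖ ≤
      A * ∑ i ∈ s, schwartzSeminormFamily ℂ E ℂ i (SchwartzMap.smulLeftCLM ℂ M g) := by
    refine (hA (SchwartzMap.smulLeftCLM ℂ M g)).trans ?_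
    rw [smul_apply]
    have := Seminorm.finset_sup_le_sum (schwartzSeminormFamily ℂ E ℂ) s
      (SchwartzMap.smulLeftCLM ℂ M g)
    rw [sum_apply] at this
    exact mul_le_mul_of_nonneg_left this A.2
  calc R ^ N * ‖T (SchwartzMap.smulLeftCLM ℂ M g)‖
      ≤ R ^ N * (A * ∑ i ∈ s,
          schwartzSeminormFamily ℂ E ℂ i (SchwartzMap.smulLeftCLM ℂ M g)) := by gcongr
    _ = A * ∑ i ∈ s, R ^ N *
          schwartzSeminormFamily ℂ E ℂ i (SchwartzMap.smulLeftCLM ℂ M g) := by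
        rw [← Finset.mul_sum]; ring
    _ ≤ A * ∑ i ∈ s, C i := by
        gcongr with i
        exact hC i M hM hB R hR hvan

end Multipliers

/-! ### Translation in frequency as modulation in space. -/

section Modulation

variable {V : Type*} [NormedAddCommGroup V] [InnerProductSpace ℝ V] [FiniteDimensional ℝ V]
  [MeasurableSpace V] [BorelSpace V]

theorem fourier_compSubConstCLM_apply (c : V) (v : 𝓢(V, ℂ)) (x : V) :
    𝓕 (v.compSubConstCLM ℂ c) x = (Real.fourierChar (-inner ℝ c x) : ℂ) * 𝓕 v x := by
  have h := congrFun (VectorFourier.fourierIntegral_comp_add_right Real.fourierChar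
    (volume : Measure V) (innerₗ V) (v : V → ℂ) (-c)) x
  rw [SchwartzMap.fourier_coe, SchwartzMap.fourier_coe]
  have hf : (v.compSubConstCLM ℂ c : V → ℂ) = (v : V → ℂ) ∘ fun y => y + -c := by
    ext y; simp [sub_eq_add_neg]
  rw [hf]
  refine Eq.trans h ?_
  simp only [map_neg, LinearMap.neg_apply, innerₗ_apply_apply, Circle.smul_def, smul_eq_mul]
  rfl

theorem fourierInv_compSubConstCLM_apply (c : V) (v : 𝓢(V, ℂ)) (x : V) :
    𝓕⁻ (v.compSubConstCLM ℂ c) x = (Real.fourierChar (inner ℝ c x) : ℂ) * 𝓕⁻ v x := by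
  have h := fourier_compSubConstCLM_apply c v (-x)
  have key : ∀ w : 𝓢(V, ℂ), 𝓕⁻ w x = 𝓕 w (-x) := fun w => by
    rw [SchwartzMap.fourierInv_coe, SchwartzMap.fourier_coe, Real.fourierInv_eq_fourier_neg]
  rw [key, key, h]
  simp

theorem norm_toLp_congr {p : ℝ≥0∞} {f g : 𝓢(V, ℂ)} (h : ∀ x, ‖f x‖ = ‖g x‖) :
    ‖f.toLp p‖ = ‖g.toLp p‖ := by
  rw [SchwartzMap.norm_toLp, SchwartzMap.norm_toLp,
    eLpNorm_congr_norm_ae (Eventually.of_forall h)]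

omit [FiniteDimensional ℝ V] [MeasurableSpace V] [BorelSpace V] in
theorem smulLeftCLM_compSubConstCLM {M : V → ℂ} (hM : M.HasTemperateGrowth) (c : V)
    (v : 𝓢(V, ℂ)) :
    SchwartzMap.smulLeftCLM ℂ M (v.compSubConstCLM ℂ c) =
      (SchwartzMap.smulLeftCLM ℂ (fun ζ => M (ζ + c)) v).compSubConstCLM ℂ c := by
  have hM' : (fun ζ => M (ζ + c)).HasTemperateGrowth := hM.comp (g := M) (f := fun ζ => ζ + c)
    (by fun_prop)
  ext x
  simp [hM, hM']

end Modulation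

/-- Hölder's inequality; `(1 - p⁻¹)⁻¹` is the conjugate exponent, endpoints included. Without an
`L_p` representative the right side is infinite unless `w = 0`. -/
theorem enorm_apply_le_lpNorm_mul {d : ℕ} (p : ℝ≥0∞) [Fact (1 ≤ p)]
    (u : 𝓢'(EuclideanSpace ℝ (Fin d), ℂ)) (w : 𝓢(EuclideanSpace ℝ (Fin d), ℂ)) :
    ‖u w‖ₑ ≤ ‖w.toLp (1 - p⁻¹)⁻¹‖ₑ * lpNorm p u := by
  have hp : 1 ≤ p := Fact.out
  have := ENNReal.HolderConjugate.inv_one_sub_inv' hp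
  have : Fact (1 ≤ (1 - p⁻¹)⁻¹) := by simp [fact_iff]
  by_cases htop : lpNorm p u = ∞
  · by_cases hw : w = 0
    · simp [hw]
    · have hne : ‖w.toLp (1 - p⁻¹)⁻¹‖ₑ ≠ 0 := fun h0 => hw <|
        SchwartzMap.injective_toLp (1 - p⁻¹)⁻¹ (volume : Measure (EuclideanSpace ℝ (Fin d))) <|
          (enorm_eq_zero.1 h0).trans (SchwartzMap.toLpCLM ℂ ℂ (1 - p⁻¹)⁻¹ volume).map_zero.symm
      rw [htop, ENNReal.mul_top hne]
      exact le_top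
  refine ENNReal.le_mul_of_forall_lt (Or.inr htop) (Or.inl enorm_ne_top) fun b hb a ha => ?_
  obtain ⟨h, hh⟩ := iInf_lt_iff.1 ha
  obtain ⟨hu, hlt⟩ := iInf_lt_iff.1 hh
  refine le_trans ?_ (mul_le_mul' hb.le hlt.le)
  rw [← hu, Lp.toTemperedDistribution_apply]
  calc ‖∫ x, w x • h x‖ₑ ≤ ∫⁻ x, ‖w x • h x‖ₑ := enorm_integral_le_lintegral_enorm _
    _ = eLpNorm (⇑w • ⇑h) 1 volume := by rw [eLpNorm_one_eq_lintegral_enorm]; rfl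
    _ ≤ eLpNorm w (1 - p⁻¹)⁻¹ volume * eLpNorm h p volume :=
        eLpNorm_smul_le_mul_eLpNorm (Lp.aestronglyMeasurable h)
          w.continuous.aestronglyMeasurable
    _ = _ := by
        rw [Lp.enorm_def, Lp.enorm_def, eLpNorm_congr_ae (w.coeFn_toLp _ _)]

/-! ### Dyadic symbols and low-pass cutoffs. -/

variable {d : ℕ} {φ₀ : ℝ → ℝ}

theorem IsGenerator.eq_zero (h : IsGenerator φ₀) {t : ℝ} (ht : 3 / 2 < |t|) : φ₀ t = 0 := by
  by_contra hne
  have := h.tsupport_subset (subset_tsupport _ hne)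
  exact absurd (abs_le.2 this) (not_le.2 ht)

theorem IsGenerator.eq_one' (h : IsGenerator φ₀) {t : ℝ} (ht : |t| ≤ 1) : φ₀ t = 1 :=
  h.eq_one t (abs_le.1 ht)

theorem IsGenerator.hasCompactSupport (h : IsGenerator φ₀) : HasCompactSupport φ₀ :=
  isCompact_Icc.of_isClosed_subset (isClosed_tsupport _) h.tsupport_subset

theorem IsGenerator.hasTemperateGrowth (h : IsGenerator φ₀) : φ₀.HasTemperateGrowth :=
  h.hasCompactSupport.hasTemperateGrowth h.contDiff

theorem hasTemperateGrowth_prod {E ι : Type*} [NormedAddCommGroup E] [NormedSpace ℝ E]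
    (s : Finset ι) {f : ι → E → ℝ} (hf : ∀ i, (f i).HasTemperateGrowth) :
    (fun x => ∏ i ∈ s, f i x).HasTemperateGrowth := by
  classical
  induction s using Finset.induction_on with
  | empty => simpa only [Finset.prod_empty] using Function.HasTemperateGrowth.const (1 : ℝ)
  | insert i s hi ih =>
    simp only [Finset.prod_insert hi]
    exact (hf i).mul ih

theorem hasTemperateGrowth_ofReal {E : Type*} [NormedAddCommGroup E] [NormedSpace ℝ E]
    {f : E → ℝ} (hf : f.HasTemperateGrowth) : (fun x => (f x : ℂ)).HasTemperateGrowth :=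
  Complex.ofRealCLM.hasTemperateGrowth.comp (g := Complex.ofRealCLM) hf

theorem IsGenerator.hasTemperateGrowth_coord (h : IsGenerator φ₀) (c : ℝ) (i : Fin d) :
    (fun η : EuclideanSpace ℝ (Fin d) => φ₀ (c * η i)).HasTemperateGrowth :=
  h.hasTemperateGrowth.comp (g := φ₀)
    (c • (EuclideanSpace.proj i : EuclideanSpace ℝ (Fin d) →L[ℝ] ℝ)).hasTemperateGrowth

/-- The low-pass symbol `η ↦ ∏ φ₀(a_i η_i)`. -/
noncomputable def cutoff (φ₀ : ℝ → ℝ) (a : Fin d → ℝ) (η : EuclideanSpace ℝ (Fin d)) : ℂ :=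
  ((∏ i, φ₀ (a i * η i) : ℝ) : ℂ)

theorem IsGenerator.hasTemperateGrowth_cutoff (h : IsGenerator φ₀) (a : Fin d → ℝ) :
    (cutoff φ₀ a).HasTemperateGrowth :=
  hasTemperateGrowth_ofReal (hasTemperateGrowth_prod Finset.univ fun i => h.hasTemperateGrowth_coord (a i) i)

theorem cutoff_eq_one (h : IsGenerator φ₀) {a : Fin d → ℝ} {η : EuclideanSpace ℝ (Fin d)}
    (hη : ∀ i, |a i * η i| ≤ 1) : cutoff φ₀ a η = 1 := by
  simp [cutoff, h.eq_one' (hη _)]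

theorem cutoff_eq_zero (h : IsGenerator φ₀) {a : Fin d → ℝ} {η : EuclideanSpace ℝ (Fin d)}
    (i : Fin d) (hη : 3 / 2 < |a i * η i|) : cutoff φ₀ a η = 0 := by
  rw [cutoff, Finset.prod_eq_zero (Finset.mem_univ i) (h.eq_zero hη), Complex.ofReal_zero]

/-- The diagonal linear map with entries `a`. -/
noncomputable def diag (a : Fin d → ℝ) :
    EuclideanSpace ℝ (Fin d) →L[ℝ] EuclideanSpace ℝ (Fin d) :=
  LinearMap.toContinuousLinearMap
    { toFun := fun x => WithLp.toLp 2 fun i => a i * x i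
      map_add' := fun x y => by ext i; simp [mul_add]
      map_smul' := fun c x => by ext i; simp [mul_left_comm] }

theorem diag_apply (a : Fin d → ℝ) (x : EuclideanSpace ℝ (Fin d)) (i : Fin d) :
    diag a x i = a i * x i := rfl

theorem norm_diag_le {a : Fin d → ℝ} {A : ℝ} (hA : 0 ≤ A) (ha : ∀ i, |a i| ≤ A) :
    ‖diag a‖ ≤ A := by
  refine ContinuousLinearMap.opNorm_le_bound _ hA fun x => ?_
  refine abs_le_of_sq_le_sq' ?_ (by positivity) |>.2
  rw [mul_pow, EuclideanSpace.norm_sq_eq, EuclideanSpace.norm_sq_eq, Finset.mul_sum]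
  refine Finset.sum_le_sum fun i _ => ?_
  rw [diag_apply, norm_mul, mul_pow]
  gcongr
  exact ha i

/-- All these symbols are one compactly supported bump composed with a diagonal map and a
translation, so the chain rule costs only `A ^ m`. Uniformity in `a` and `c` lets one constant serve
all levels and all frequencies. -/
theorem exists_norm_iteratedFDeriv_cutoff_le (h : IsGenerator φ₀) (d : ℕ) {A : ℝ} (hA : 0 ≤ A) :
    ∃ B : ℕ → ℝ, ∀ a : Fin d → ℝ, (∀ i, |a i| ≤ A) → ∀ c m x,
      ‖iteratedFDeriv ℝ m (fun ζ => cutoff φ₀ a (ζ + c)) x‖ ≤ B m := by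
  set Φ : EuclideanSpace ℝ (Fin d) → ℂ := cutoff φ₀ 1 with hΦ
  have hsm : ContDiff ℝ ((⊤ : ℕ∞) : WithTop ℕ∞) Φ := (h.hasTemperateGrowth_cutoff 1).1
  have hcs : HasCompactSupport Φ := by
    refine HasCompactSupport.intro (K := {x | ∀ i, x i ∈ Set.Icc (-(3 / 2) : ℝ) (3 / 2)}) ?_ ?_
    · have := (isCompact_univ_pi fun _ : Fin d => isCompact_Icc (a := (-(3 / 2) : ℝ))
        (b := 3 / 2)).image (PiLp.continuous_toLp 2 (fun _ : Fin d => ℝ))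
      convert this using 1
      ext x
      simp only [Set.mem_ofPred_eq, Set.mem_image, Set.mem_univ_pi]
      exact ⟨fun hx => ⟨x, hx, rfl⟩, by rintro ⟨y, hy, rfl⟩; exact hy⟩
    · intro x hx
      simp only [Set.mem_ofPred_eq, not_forall] at hx
      obtain ⟨i, hi⟩ := hx
      refine cutoff_eq_zero h i ?_
      rw [← not_le, abs_le]
      simpa using hi
  have hb : ∀ m, ∃ D, ∀ x, ‖iteratedFDeriv ℝ m Φ x‖ ≤ D := fun m =>
    (hsm.continuous_iteratedFDeriv (m := m) (mod_cast le_top)).bounded_above_of_compact_support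
      (hcs.iteratedFDeriv m)
  choose D hD using hb
  refine ⟨fun m => D m * A ^ m, fun a ha c m x => ?_⟩
  have h1 : cutoff φ₀ a = Φ ∘ diag a := by
    ext η; simp [hΦ, cutoff, diag_apply]
  rw [iteratedFDeriv_comp_add_right' m c (f := cutoff φ₀ a), h1]
  beta_reduce
  rw [ContinuousLinearMap.iteratedFDeriv_comp_right _ hsm _ (mod_cast le_top)]
  refine (ContinuousMultilinearMap.norm_compContinuousLinearMap_le _ _).trans ?_
  rw [Finset.prod_const, Finset.card_univ, Fintype.card_fin]
  gcongr
  · exact (norm_nonneg _).trans (hD m 0)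
  · exact hD m _
  · exact norm_diag_le hA ha

/-- The symbol of `dyadicBlock φ₀ k`. -/
noncomputable def blockSymbol (φ₀ : ℝ → ℝ) (k : Fin d → ℕ) (η : EuclideanSpace ℝ (Fin d)) : ℂ :=
  (dyadicTensor φ₀ k ((2 * Real.pi) • η) : ℂ)

theorem dyadicBlock_eq (k : Fin d → ℕ) :
    dyadicBlock φ₀ k = TemperedDistribution.fourierMultiplierCLM ℂ (blockSymbol φ₀ k) := rfl

theorem hasTemperateGrowth_blockSymbol (h : IsGenerator φ₀) (k : Fin d → ℕ) :
    (blockSymbol φ₀ k).HasTemperateGrowth := by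
  refine hasTemperateGrowth_ofReal (hasTemperateGrowth_prod Finset.univ fun i => ?_)
  cases hk : k i with
  | zero => exact h.hasTemperateGrowth_coord (2 * Real.pi) i
  | succ j =>
    convert (h.hasTemperateGrowth_coord (2 * Real.pi / 2 ^ (j + 1)) i).sub
      (h.hasTemperateGrowth_coord (2 * Real.pi / 2 ^ j) i) using 1
    ext η
    simp only [dyadic, PiLp.smul_apply, smul_eq_mul, Pi.sub_apply]
    congr 2 <;> ring

theorem sum_range_dyadic (φ₀ : ℝ → ℝ) (K : ℕ) (t : ℝ) :
    ∑ j ∈ Finset.range (K + 1), dyadic φ₀ j t = φ₀ (t / 2 ^ K) := by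
  induction K with
  | zero => simp [dyadic]
  | succ K ih => rw [Finset.sum_range_succ, ih]; simp [dyadic]

theorem dyadic_eq_zero_of_lt (h : IsGenerator φ₀) {j : ℕ} {t : ℝ} (ht : 2 ^ (j + 1) < |t|) :
    dyadic φ₀ j t = 0 := by
  have aux : ∀ m ≤ j, φ₀ (t / 2 ^ m) = 0 := fun m hm => h.eq_zero <| by
    rw [abs_div, abs_of_pos (by positivity : (0 : ℝ) < 2 ^ m), lt_div_iff₀ (by positivity)]
    calc 3 / 2 * (2 : ℝ) ^ m ≤ 2 * 2 ^ j := by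
          gcongr
          · norm_num
          · norm_num
      _ = 2 ^ (j + 1) := by ring
      _ < |t| := ht
  cases j with
  | zero => simpa [dyadic] using aux 0 le_rfl
  | succ j => simp [dyadic, aux (j + 1) le_rfl, aux j (Nat.le_succ j)]

theorem dyadic_of_abs_le_one (h : IsGenerator φ₀) {t : ℝ} (ht : |t| ≤ 1) (l : ℕ) :
    dyadic φ₀ l t = if l = 0 then 1 else 0 := by
  have aux : ∀ m : ℕ, φ₀ (t / 2 ^ m) = 1 := fun m => h.eq_one' <| by
    rw [abs_div, abs_of_pos (by positivity : (0 : ℝ) < 2 ^ m)]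
    exact (div_le_self (abs_nonneg t) (one_le_pow₀ (by norm_num))).trans ht
  cases l with
  | zero => simpa [dyadic] using aux 0
  | succ l => simp [dyadic, aux]

/-- On this interval `φ₀ (t / 2 ^ m)` is `1` for `m ≥ j` and `0` for `m < j`, so only the difference
at level `j` survives. -/
theorem dyadic_of_mem (h : IsGenerator φ₀) {j : ℕ} (hj : 1 ≤ j) {t : ℝ}
    (h1 : 3 / 4 * 2 ^ j < t) (h2 : t ≤ 2 ^ j) (l : ℕ) :
    dyadic φ₀ l t = if l = j then 1 else 0 := by
  have ht : 0 < t := lt_trans (by positivity) h1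
  have big : ∀ m, j ≤ m → φ₀ (t / 2 ^ m) = 1 := fun m hm => h.eq_one' <| by
    rw [abs_of_pos (by positivity), div_le_one (by positivity)]
    exact h2.trans (pow_le_pow_right₀ (by norm_num) hm)
  have small : ∀ m, m < j → φ₀ (t / 2 ^ m) = 0 := fun m hm => h.eq_zero <| by
    rw [abs_of_pos (by positivity), lt_div_iff₀ (by positivity)]
    have : (2 : ℝ) ^ (m + 1) ≤ 2 ^ j := pow_le_pow_right₀ (by norm_num) hm
    rw [pow_succ] at this
    linarith
  cases l with
  | zero =>
    have := small 0 (by omega)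
    rw [if_neg (by omega)]
    simpa [dyadic] using this
  | succ l =>
    rw [dyadic]
    split_ifs with hl
    · rw [big (l + 1) hl.ge, small l (by omega)]; norm_num
    · rcases lt_or_gt_of_ne hl with hl | hl
      · rw [small (l + 1) hl, small l (by omega)]; norm_num
      · rw [big (l + 1) hl.le, big l (by omega)]; norm_num

/-- The sum over a box factorises over coordinates, and each factor telescopes. -/
theorem sum_blockSymbol (φ₀ : ℝ → ℝ) (K : ℕ) (η : EuclideanSpace ℝ (Fin d)) :
    ∑ k ∈ Fintype.piFinset (fun _ : Fin d => Finset.range (K + 1)), blockSymbol φ₀ k η =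
      cutoff φ₀ (fun _ => 2 * Real.pi / 2 ^ K) η := by
  simp only [blockSymbol, cutoff, dyadicTensor, ← Complex.ofReal_sum]
  rw [← Finset.prod_univ_sum (fun _ : Fin d => Finset.range (K + 1))
    (fun i l => dyadic φ₀ l (((2 * Real.pi) • η) i))]
  congr 1
  refine Finset.prod_congr rfl fun i _ => ?_
  rw [sum_range_dyadic]
  congr 1
  simp only [PiLp.smul_apply, smul_eq_mul]
  ring

theorem blockSymbol_mul_cutoff (h : IsGenerator φ₀) (k : Fin d → ℕ) :
    blockSymbol φ₀ k * cutoff φ₀ (fun i => 2 * Real.pi / 2 ^ (k i + 1)) = blockSymbol φ₀ k := by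
  ext η
  rw [Pi.mul_apply]
  by_cases hη : ∀ i, |2 * Real.pi * η i| ≤ 2 ^ (k i + 1)
  · rw [cutoff_eq_one h, mul_one]
    intro i
    rw [div_mul_eq_mul_div, abs_div, abs_of_pos (by positivity : (0 : ℝ) < 2 ^ (k i + 1)),
      div_le_one (by positivity)]
    exact hη i
  · push Not at hη
    obtain ⟨i, hi⟩ := hη
    have : blockSymbol φ₀ k η = 0 := by
      rw [blockSymbol, dyadicTensor, Finset.prod_eq_zero (Finset.mem_univ i), Complex.ofReal_zero]
      exact dyadic_eq_zero_of_lt h hi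
    rw [this, zero_mul]

/-! ### Convergence of the dyadic decomposition. -/

theorem tendsto_sum_dyadicBlock (hφ : IsGenerator φ₀) (G : 𝓢'(EuclideanSpace ℝ (Fin d), ℂ))
    (h : 𝓢(EuclideanSpace ℝ (Fin d), ℂ)) :
    Tendsto (fun K : ℕ => ∑ k ∈ Fintype.piFinset (fun _ : Fin d => Finset.range (K + 1)),
      dyadicBlock φ₀ k G h) atTop (𝓝 (G h)) := by
  set T : 𝓢(EuclideanSpace ℝ (Fin d), ℂ) →L[ℂ] ℂ :=
    (G : 𝓢(EuclideanSpace ℝ (Fin d), ℂ) →L[ℂ] ℂ).comp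
      (fourierCLM ℂ 𝓢(EuclideanSpace ℝ (Fin d), ℂ)) with hT
  have hTa : ∀ v, T v = G (𝓕 v) := fun v => rfl
  obtain ⟨B, hB⟩ := exists_norm_iteratedFDeriv_cutoff_le hφ d Real.two_pi_pos.le
  -- The remainder symbol `1 - cutoff` vanishes on the ball of radius `2 ^ K / (2π)`, so the first
  -- power of decay already gives an error `O(2 ^ (-K))`. The summand `1` in the bounds pays for the
  -- constant function.
  obtain ⟨C, hC0, hC⟩ := exists_pow_mul_norm_smulLeftCLM_le T (𝓕⁻ h) (fun m => 1 + B m) 1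
  set a : ℕ → Fin d → ℝ := fun K _ => 2 * Real.pi / 2 ^ K with ha
  have ha' : ∀ K i, |a K i| ≤ 2 * Real.pi := fun K i => by
    rw [ha, abs_of_pos (by positivity)]
    exact div_le_self Real.two_pi_pos.le (one_le_pow₀ (by norm_num))
  have hsum : ∀ K : ℕ, ∑ k ∈ Fintype.piFinset (fun _ : Fin d => Finset.range (K + 1)),
      dyadicBlock φ₀ k G h = T (SchwartzMap.smulLeftCLM ℂ (cutoff φ₀ (a K)) (𝓕⁻ h)) := by
    intro K
    have h1 : cutoff φ₀ (a K) = fun η =>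
        ∑ k ∈ Fintype.piFinset (fun _ : Fin d => Finset.range (K + 1)), blockSymbol φ₀ k η := by
      ext η; rw [sum_blockSymbol]
    rw [h1, SchwartzMap.smulLeftCLM_sum fun k _ => hasTemperateGrowth_blockSymbol hφ k]
    rw [sum_apply, map_sum]
    rfl
  have hdiff : ∀ K : ℕ, G h - T (SchwartzMap.smulLeftCLM ℂ (cutoff φ₀ (a K)) (𝓕⁻ h)) =
      T (SchwartzMap.smulLeftCLM ℂ (fun η => 1 - cutoff φ₀ (a K) η) (𝓕⁻ h)) := by
    intro K
    have h1 : (fun η => 1 - cutoff φ₀ (a K) η) =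
      (fun _ : EuclideanSpace ℝ (Fin d) => (1 : ℂ)) - cutoff φ₀ (a K) := rfl
    rw [h1, SchwartzMap.smulLeftCLM_sub (Function.HasTemperateGrowth.const 1)
      (hφ.hasTemperateGrowth_cutoff _)]
    rw [sub_apply, map_sub, SchwartzMap.smulLeftCLM_const, one_smul]
    simp [hTa]
  rw [tendsto_iff_norm_sub_tendsto_zero]
  refine squeeze_zero (g := fun K : ℕ => C * (2 * Real.pi) * (1 / 2) ^ K)
    (fun _ => norm_nonneg _) (fun K => ?_) ?_
  · rw [hsum, norm_sub_rev, hdiff]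
    have hR : (0 : ℝ) < 2 ^ K / (2 * Real.pi) := by positivity
    have key := hC (fun η => 1 - cutoff φ₀ (a K) η)
      ((Function.HasTemperateGrowth.const 1).sub (hφ.hasTemperateGrowth_cutoff _)) ?_
      (2 ^ K / (2 * Real.pi)) hR.le ?_
    · rw [pow_one, mul_comm, ← le_div_iff₀ hR] at key
      refine key.trans_eq ?_
      rw [one_div, inv_pow]
      field_simp
    · intro m x
      have h1 : ContDiffAt ℝ m (cutoff φ₀ (a K)) x :=
        ((hφ.hasTemperateGrowth_cutoff (a K)).1.of_le (mod_cast le_top)).contDiffAt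
      have h2 := iteratedFDeriv_sub_apply (contDiffAt_const (c := (1 : ℂ))) h1
      have h3 : iteratedFDeriv ℝ m (fun η => 1 - cutoff φ₀ (a K) η) x =
        iteratedFDeriv ℝ m (fun _ => 1) x - iteratedFDeriv ℝ m (cutoff φ₀ (a K)) x := h2
      rw [h3]
      refine (norm_sub_le _ _).trans (add_le_add ?_ ?_)
      · rcases eq_or_ne m 0 with rfl | hm
        · simp
        · simp [iteratedFDeriv_const_of_ne hm]
      · simpa using hB (a K) (ha' K) 0 m x
    · intro x hx
      rw [cutoff_eq_one hφ, sub_self]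
      intro i
      rw [abs_mul, ha, abs_of_pos (by positivity)]
      have := (PiLp.norm_apply_le x i).trans hx.le
      rw [Real.norm_eq_abs, le_div_iff₀ (by positivity)] at this
      rw [div_mul_eq_mul_div, div_le_one (by positivity)]
      linarith
  · simpa using (tendsto_pow_atTop_nhds_zero_of_lt_one (by norm_num : (0 : ℝ) ≤ 1 / 2)
      (by norm_num)).const_mul (C * (2 * Real.pi))

theorem enorm_apply_le_tsum_dyadicBlock (hφ : IsGenerator φ₀)
    (G : 𝓢'(EuclideanSpace ℝ (Fin d), ℂ)) (h : 𝓢(EuclideanSpace ℝ (Fin d), ℂ)) :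
    ‖G h‖ₑ ≤ ∑' k : Fin d → ℕ, ‖dyadicBlock φ₀ k G h‖ₑ :=
  le_of_tendsto (tendsto_sum_dyadicBlock hφ G h).enorm <| Eventually.of_forall fun _ =>
    (enorm_sum_le _ _).trans (ENNReal.sum_le_tsum _)

/-! ### Duality estimate for test functions modulated in two directions. -/

/-- The frequency `(7/8) 2^j e_i`, in the normalisation of Mathlib's Fourier transform. -/
noncomputable def center (i : Fin d) (j : ℕ) : EuclideanSpace ℝ (Fin d) :=
  EuclideanSpace.single i (7 / 8 * 2 ^ j / (2 * Real.pi))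

theorem two_pi_mul_center (i l : Fin d) (j : ℕ) :
    2 * Real.pi * center i j l = if l = i then 7 / 8 * 2 ^ j else 0 := by
  rw [center, PiLp.single_apply]
  split_ifs
  · field_simp
  · simp

/-- The cutoff that is identically one on the support of `blockSymbol φ₀ k`. -/
noncomputable def fatSymbol (φ₀ : ℝ → ℝ) (k : Fin d → ℕ) : EuclideanSpace ℝ (Fin d) → ℂ :=
  cutoff φ₀ fun i => 2 * Real.pi / 2 ^ (k i + 1)

/-- The fat cutoff does not change the block symbol, so it can be moved onto the test function,
where it makes the dual Hölder factor small. -/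
theorem dyadicBlock_apply_eq (hφ : IsGenerator φ₀) (k : Fin d → ℕ)
    (G : 𝓢'(EuclideanSpace ℝ (Fin d), ℂ)) (h : 𝓢(EuclideanSpace ℝ (Fin d), ℂ)) :
    dyadicBlock φ₀ k G h =
      dyadicBlock φ₀ k G (𝓕 (SchwartzMap.smulLeftCLM ℂ (fatSymbol φ₀ k) (𝓕⁻ h))) := by
  simp only [dyadicBlock_eq, TemperedDistribution.fourierMultiplierCLM_apply_apply,
    FourierTransform.fourierInv_fourier_eq]
  rw [fatSymbol, SchwartzMap.smulLeftCLM_smulLeftCLM_apply (hasTemperateGrowth_blockSymbol hφ k)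
    (hφ.hasTemperateGrowth_cutoff _), blockSymbol_mul_cutoff hφ]

theorem fatSymbol_add_eq_zero (hφ : IsGenerator φ₀) {i₀ i₁ i : Fin d} (hi : i₀ ≠ i₁)
    (hii : i = i₀ ∨ i = i₁) {k : Fin d → ℕ} {j : ℕ} (hk : k i + 3 ≤ j)
    {ζ : EuclideanSpace ℝ (Fin d)} (hζ : ‖ζ‖ < 2 ^ j / 16) :
    fatSymbol φ₀ k (ζ + (center i₀ j + center i₁ j)) = 0 := by
  refine cutoff_eq_zero hφ i ?_
  have h1 : 2 * Real.pi * (ζ + (center i₀ j + center i₁ j)) i =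
      2 * Real.pi * ζ i + 7 / 8 * 2 ^ j := by
    simp only [PiLp.add_apply, mul_add, two_pi_mul_center]
    rcases hii with rfl | rfl <;> simp [hi, hi.symm]
  have h2 : |ζ i| < 2 ^ j / 16 := (PiLp.norm_apply_le ζ i).trans_lt hζ
  have hpi := Real.pi_lt_four
  have hj : (0 : ℝ) < 2 ^ j := by positivity
  have h3 : |2 * Real.pi * ζ i| < 2 ^ j / 2 := by
    rw [abs_mul, abs_of_pos Real.two_pi_pos]
    nlinarith [abs_nonneg (ζ i), Real.pi_pos]
  -- The rescaled coordinate exceeds `(7/8 - 1/2) 2^j = (3/8) 2^j ≥ (3/2) 2^(k i + 1)`, which is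
  -- just beyond the support of the cutoff.
  have h4 : (2 : ℝ) ^ (k i + 3) ≤ 2 ^ j := pow_le_pow_right₀ (by norm_num) hk
  rw [div_mul_eq_mul_div, h1, abs_div, abs_of_pos (by positivity : (0 : ℝ) < 2 ^ (k i + 1)),
    lt_div_iff₀ (by positivity)]
  rw [show k i + 3 = (k i + 1) + 2 by ring, pow_add] at h4
  have := (abs_lt.1 h3).1
  refine lt_of_lt_of_le ?_ (le_abs_self _)
  have : (0 : ℝ) < 2 ^ (k i + 1) := by positivity
  linarith

/-- Away from the frequency `center i₀ j + center i₁ j` the low-pass pieces of a modulated Schwartz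
function decay rapidly; this is recorded as a power of `2` in `|k|₁ - 2j`. -/
theorem exists_norm_fatSymbol_le (hφ : IsGenerator φ₀) {i₀ i₁ : Fin d} (hi : i₀ ≠ i₁)
    (p : ℝ≥0∞) [Fact (1 ≤ p)] {s : ℝ} (hs : 0 < s) (g : 𝓢(EuclideanSpace ℝ (Fin d), ℂ)) :
    ∃ C : ℝ, ∀ (j : ℕ) (k : Fin d → ℕ),
      ‖(𝓕 (SchwartzMap.smulLeftCLM ℂ (fatSymbol φ₀ k)
        (g.compSubConstCLM ℂ (center i₀ j + center i₁ j)))).toLp p‖ ≤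
      C * (2 : ℝ) ^ (s * (((∑ i, k i : ℕ) : ℝ) - 2 * j)) := by
  set T : 𝓢(EuclideanSpace ℝ (Fin d), ℂ) →L[ℂ]
      Lp ℂ p (volume : Measure (EuclideanSpace ℝ (Fin d))) :=
    (SchwartzMap.toLpCLM ℂ ℂ p volume).comp
      (fourierCLM ℂ 𝓢(EuclideanSpace ℝ (Fin d), ℂ)) with hT
  obtain ⟨B, hB⟩ := exists_norm_iteratedFDeriv_cutoff_le hφ d Real.two_pi_pos.le
  -- With `N ≥ 2s`, decay of order `N` at radius `2 ^ j / 16` gives `2 ^ (-2sj)`, enough for every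
  -- `k`.
  obtain ⟨N, hN⟩ := exists_nat_ge (2 * s)
  obtain ⟨C₀, hC₀, h₀⟩ := exists_pow_mul_norm_smulLeftCLM_le T g B 0
  obtain ⟨C₁, hC₁, h₁⟩ := exists_pow_mul_norm_smulLeftCLM_le T g B N
  refine ⟨max (C₀ * 2 ^ (4 * s)) (C₁ * 16 ^ N), fun j k => ?_⟩
  set c := center i₀ j + center i₁ j with hc
  have hfat : (fatSymbol φ₀ k).HasTemperateGrowth := hφ.hasTemperateGrowth_cutoff _
  have hM : (fun ζ => fatSymbol φ₀ k (ζ + c)).HasTemperateGrowth :=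
    hfat.comp (g := fatSymbol φ₀ k) (f := fun ζ => ζ + c) (by fun_prop)
  have hMB : ∀ m x, ‖iteratedFDeriv ℝ m (fun ζ => fatSymbol φ₀ k (ζ + c)) x‖ ≤ B m := by
    refine hB _ (fun i => ?_) c
    rw [abs_of_pos (by positivity)]
    exact div_le_self Real.two_pi_pos.le (one_le_pow₀ (by norm_num))
  have hnorm : ‖(𝓕 (SchwartzMap.smulLeftCLM ℂ (fatSymbol φ₀ k)
        (g.compSubConstCLM ℂ c))).toLp p‖ =
      ‖T (SchwartzMap.smulLeftCLM ℂ (fun ζ => fatSymbol φ₀ k (ζ + c)) g)‖ := by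
    rw [smulLeftCLM_compSubConstCLM hfat]
    refine norm_toLp_congr fun x => ?_
    rw [fourier_compSubConstCLM_apply, norm_mul, Circle.norm_coe, one_mul]
    rfl
  rw [hnorm]
  have hle : ∀ {A t : ℝ}, 0 ≤ A → t ≤ s * (((∑ i, k i : ℕ) : ℝ) - 2 * j) →
      A * (2 : ℝ) ^ t ≤ A * (2 : ℝ) ^ (s * (((∑ i, k i : ℕ) : ℝ) - 2 * j)) := fun hA ht =>
    mul_le_mul_of_nonneg_left (Real.rpow_le_rpow_of_exponent_le (by norm_num) ht) hA
  by_cases hfar : ∃ i, (i = i₀ ∨ i = i₁) ∧ k i + 3 ≤ j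
  · obtain ⟨i, hii, hk⟩ := hfar
    have key := h₁ _ hM hMB (2 ^ j / 16) (by positivity) fun x hx =>
      fatSymbol_add_eq_zero hφ hi hii hk hx
    rw [mul_comm, ← le_div_iff₀ (by positivity)] at key
    refine key.trans ?_
    have h2 : C₁ / (2 ^ j / 16) ^ N = (C₁ * 16 ^ N) * (2 : ℝ) ^ (-(N * j : ℝ)) := by
      rw [Real.rpow_neg (by norm_num), mul_comm (N : ℝ), Real.rpow_mul (by norm_num),
        Real.rpow_natCast, Real.rpow_natCast, div_pow]
      field_simp
    rw [h2]
    refine (hle (by positivity) ?_).trans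
      (mul_le_mul_of_nonneg_right (le_max_right _ _) (by positivity))
    have h3 : 2 * s * j ≤ N * (j : ℝ) := by gcongr
    have h4 : 0 ≤ s * ((∑ i, k i : ℕ) : ℝ) := by positivity
    linarith
  -- Both levels are now at least `j - 2`, so `|k|₁ ≥ 2j - 4` and a bound without decay suffices, at
  -- the price of the factor `2 ^ (4s)`.
  · push Not at hfar
    have key := h₀ _ hM hMB 0 le_rfl fun x hx => absurd hx (not_lt.2 (norm_nonneg x))
    rw [pow_zero, one_mul] at key
    have h2 : C₀ = (C₀ * 2 ^ (4 * s)) * (2 : ℝ) ^ (-(4 * s)) := by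
      rw [mul_assoc, ← Real.rpow_add (by norm_num)]
      simp
    refine key.trans <| h2.le.trans <| (hle (by positivity) ?_).trans
      (mul_le_mul_of_nonneg_right (le_max_left _ _) (by positivity))
    have h3 : k i₀ + k i₁ ≤ ∑ i, k i := Finset.add_le_sum (fun _ _ => Nat.zero_le _)
      (Finset.mem_univ _) (Finset.mem_univ _) hi
    have h4 := hfar i₀ (Or.inl rfl)
    have h5 := hfar i₁ (Or.inr rfl)
    have h6 : 2 * j ≤ (∑ i, k i) + 4 := by omega
    have h7 : (2 * j : ℝ) ≤ ((∑ i, k i : ℕ) : ℝ) + 4 := by exact_mod_cast h6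
    nlinarith

/-- Every finite set of indices lies in a box, over which the sum is a product of partial geometric
sums. -/
theorem tsum_prod_pow_ne_top {x : ℝ≥0∞} (hx : x < 1) :
    ∑' k : Fin d → ℕ, ∏ i, x ^ k i ≠ ∞ := by
  have h1 : ∑' n : ℕ, x ^ n ≠ ∞ := by
    rw [ENNReal.tsum_geometric]
    exact ENNReal.inv_ne_top.2 (tsub_pos_of_lt hx).ne'
  refine ne_top_of_le_ne_top (ENNReal.pow_ne_top h1 (n := d)) ?_
  rw [ENNReal.tsum_eq_iSup_sum]
  refine iSup_le fun S => ?_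
  set K := S.sup fun k => ∑ i, k i with hK
  have hS : S ⊆ Fintype.piFinset fun _ : Fin d => Finset.range (K + 1) := fun k hk => by
    rw [Fintype.mem_piFinset]
    intro i
    rw [Finset.mem_range, Nat.lt_succ_iff]
    exact (Finset.single_le_sum (fun _ _ => Nat.zero_le _) (Finset.mem_univ i)).trans
      (Finset.le_sup (f := fun k : Fin d → ℕ => ∑ i, k i) hk)
  refine (Finset.sum_le_sum_of_subset hS).trans ?_
  rw [← Finset.prod_univ_sum (fun _ : Fin d => Finset.range (K + 1)) (fun _ n => x ^ n),
    Finset.prod_const, Finset.card_univ, Fintype.card_fin]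
  exact pow_le_pow_left' (ENNReal.sum_le_tsum _) d

theorem mul_lpNorm_dyadicBlock_le_besovNorm (p q : ℝ≥0∞) [Fact (1 ≤ p)] (hq : 1 ≤ q) (r : ℝ)
    (G : 𝓢'(EuclideanSpace ℝ (Fin d), ℂ)) (k : Fin d → ℕ) :
    (2 : ℝ≥0∞) ^ (r * ((∑ i, k i : ℕ) : ℝ)) * lpNorm p (dyadicBlock φ₀ k G) ≤
      besovNorm φ₀ p q r G := by
  rw [besovNorm]
  split_ifs with h
  · exact le_iSup (fun k : Fin d → ℕ =>
      (2 : ℝ≥0∞) ^ (r * ((∑ i, k i : ℕ) : ℝ)) * lpNorm p (dyadicBlock φ₀ k G)) k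
  · have hq0 : 0 < q.toReal := ENNReal.toReal_pos (zero_lt_one.trans_le hq).ne' h
    rw [one_div, ENNReal.le_rpow_inv_iff hq0]
    exact ENNReal.le_tsum k

theorem exists_enorm_apply_le_besovNorm (hφ : IsGenerator φ₀) {i₀ i₁ : Fin d} (hi : i₀ ≠ i₁)
    (p q : ℝ≥0∞) [Fact (1 ≤ p)] (hq : 1 ≤ q) {r : ℝ} (hr : 0 < r)
    (g : 𝓢(EuclideanSpace ℝ (Fin d), ℂ)) :
    ∃ C : ℝ≥0∞, C ≠ ∞ ∧ ∀ (j : ℕ) (G : 𝓢'(EuclideanSpace ℝ (Fin d), ℂ)),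
      ‖G (𝓕 (g.compSubConstCLM ℂ (center i₀ j + center i₁ j)))‖ₑ ≤
        C * (2 : ℝ≥0∞) ^ (-(3 / 2 * r * j)) * besovNorm φ₀ p q r G := by
  have : Fact (1 ≤ (1 - p⁻¹)⁻¹) := by simp [fact_iff]
  -- Any `s` strictly between `r/2` and `r` would do: `s < r` leaves a summable `2^(-(r-s)|k|₁)`,
  -- and `s > r/2` makes the gain `2^(2sj)` exceed `2^(rj)`.
  obtain ⟨C, hC⟩ := exists_norm_fatSymbol_le hφ hi (1 - p⁻¹)⁻¹
    (s := 3 / 4 * r) (by positivity) g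
  set x : ℝ≥0∞ := (2 : ℝ≥0∞) ^ (-(r / 4)) with hx
  have hx1 : x < 1 := ENNReal.rpow_lt_one_of_one_lt_of_neg (by norm_num) (by linarith)
  refine ⟨ENNReal.ofReal C * ∑' k : Fin d → ℕ, ∏ i, x ^ k i,
    ENNReal.mul_ne_top ENNReal.ofReal_ne_top (tsum_prod_pow_ne_top hx1), fun j G => ?_⟩
  refine (enorm_apply_le_tsum_dyadicBlock hφ G _).trans ?_
  rw [show ∀ a b c e : ℝ≥0∞, a * b * c * e = (a * c * e) * b by intros; ring,
    ← ENNReal.tsum_mul_left]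
  refine ENNReal.tsum_le_tsum fun k => ?_
  set n : ℝ := ((∑ i, k i : ℕ) : ℝ) with hn
  rw [dyadicBlock_apply_eq hφ, FourierTransform.fourierInv_fourier_eq]
  refine (enorm_apply_le_lpNorm_mul p _ _).trans ?_
  have h1 : ‖(𝓕 (SchwartzMap.smulLeftCLM ℂ (fatSymbol φ₀ k)
      (g.compSubConstCLM ℂ (center i₀ j + center i₁ j)))).toLp (1 - p⁻¹)⁻¹‖ₑ ≤
      ENNReal.ofReal C * (2 : ℝ≥0∞) ^ (3 / 4 * r * (n - 2 * j)) := by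
    rw [← ofReal_norm]
    refine (ENNReal.ofReal_le_ofReal (hC j k)).trans_eq ?_
    rw [ENNReal.ofReal_mul' (by positivity), ← ENNReal.ofReal_rpow_of_pos (by norm_num),
      ENNReal.ofReal_ofNat]
  have h2 : lpNorm p (dyadicBlock φ₀ k G) ≤
      (2 : ℝ≥0∞) ^ (-(r * n)) * besovNorm φ₀ p q r G := by
    refine le_trans ?_ (mul_le_mul_right (mul_lpNorm_dyadicBlock_le_besovNorm p q hq r G k) _)
    rw [← mul_assoc, ← ENNReal.rpow_add _ _ two_ne_zero ENNReal.ofNat_ne_top, neg_add_cancel,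
      ENNReal.rpow_zero, one_mul]
  refine (mul_le_mul' h1 h2).trans_eq ?_
  have h3 : ∏ i, x ^ k i = (2 : ℝ≥0∞) ^ (-(r / 4) * n) := by
    rw [Finset.prod_pow_eq_pow_sum, ENNReal.rpow_mul, hn, ENNReal.rpow_natCast]
  rw [h3]
  calc ENNReal.ofReal C * (2 : ℝ≥0∞) ^ (3 / 4 * r * (n - 2 * j)) *
        ((2 : ℝ≥0∞) ^ (-(r * n)) * besovNorm φ₀ p q r G)
      = ENNReal.ofReal C * ((2 : ℝ≥0∞) ^ (3 / 4 * r * (n - 2 * j)) * (2 : ℝ≥0∞) ^ (-(r * n))) *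
          besovNorm φ₀ p q r G := by ring
    _ = ENNReal.ofReal C * ((2 : ℝ≥0∞) ^ (-(3 / 2 * r * j)) * (2 : ℝ≥0∞) ^ (-(r / 4) * n)) *
          besovNorm φ₀ p q r G := by
        rw [← ENNReal.rpow_add _ _ two_ne_zero ENNReal.ofNat_ne_top,
          ← ENNReal.rpow_add _ _ two_ne_zero ENNReal.ofNat_ne_top]
        congr 3
        ring
    _ = _ := by ring

/-! ### Waves concentrated in a single dyadic block. -/

theorem lpNorm_toTemperedDistributionCLM_le (p : ℝ≥0∞) [Fact (1 ≤ p)]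
    (f : 𝓢(EuclideanSpace ℝ (Fin d), ℂ)) :
    lpNorm p (SchwartzMap.toTemperedDistributionCLM (EuclideanSpace ℝ (Fin d)) ℂ volume f) ≤
      ‖f.toLp p‖ₑ := by
  have h : Lp.toTemperedDistribution (f.toLp p) =
    SchwartzMap.toTemperedDistributionCLM (EuclideanSpace ℝ (Fin d)) ℂ volume f :=
    Lp.toTemperedDistribution_toLp_eq f
  refine (iInf_le _ (f.toLp p volume)).trans (iInf_le _ ?_)
  exact h

theorem lpNorm_zero (p : ℝ≥0∞) [Fact (1 ≤ p)] :
    lpNorm p (0 : 𝓢'(EuclideanSpace ℝ (Fin d), ℂ)) = 0 := by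
  have := lpNorm_toTemperedDistributionCLM_le p (0 : 𝓢(EuclideanSpace ℝ (Fin d), ℂ))
  have h0 : ‖(0 : 𝓢(EuclideanSpace ℝ (Fin d), ℂ)).toLp p‖ₑ = 0 :=
    enorm_eq_zero.2 (SchwartzMap.toLpCLM ℂ ℂ p volume).map_zero
  rw [map_zero, h0] at this
  exact le_antisymm this zero_le

theorem besovNorm_le_of_single_block (p q : ℝ≥0∞) [Fact (1 ≤ p)] (hq : 1 ≤ q) (r : ℝ)
    {u : 𝓢'(EuclideanSpace ℝ (Fin d), ℂ)} {k₀ : Fin d → ℕ}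
    (hu : ∀ k, dyadicBlock φ₀ k u = if k = k₀ then u else 0) :
    besovNorm φ₀ p q r u ≤ (2 : ℝ≥0∞) ^ (r * ((∑ i, k₀ i : ℕ) : ℝ)) * lpNorm p u := by
  rw [besovNorm]
  split_ifs with h
  · refine iSup_le fun k => ?_
    rw [hu]
    split_ifs with hk
    · rw [hk]
    · simp [lpNorm_zero]
  · have hq0 : 0 < q.toReal := ENNReal.toReal_pos (zero_lt_one.trans_le hq).ne' h
    rw [tsum_eq_single k₀ fun k hk => by rw [hu, if_neg hk, lpNorm_zero, mul_zero,
      ENNReal.zero_rpow_of_pos hq0], hu, if_pos rfl, one_div, ENNReal.rpow_rpow_inv hq0.ne']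

/-- The Schwartz function with Fourier transform `ψ(· - center i j)`. -/
noncomputable def wave (ψ : 𝓢(EuclideanSpace ℝ (Fin d), ℂ)) (i : Fin d) (j : ℕ) :
    𝓢(EuclideanSpace ℝ (Fin d), ℂ) :=
  𝓕⁻ (ψ.compSubConstCLM ℂ (center i j))

theorem wave_apply (ψ : 𝓢(EuclideanSpace ℝ (Fin d), ℂ)) (i : Fin d) (j : ℕ)
    (x : EuclideanSpace ℝ (Fin d)) :
    wave ψ i j x = (Real.fourierChar (inner ℝ (center i j) x) : ℂ) * 𝓕⁻ ψ x :=
  fourierInv_compSubConstCLM_apply _ _ _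

theorem norm_wave_apply (ψ : 𝓢(EuclideanSpace ℝ (Fin d), ℂ)) (i : Fin d) (j : ℕ)
    (x : EuclideanSpace ℝ (Fin d)) : ‖wave ψ i j x‖ = ‖𝓕⁻ ψ x‖ := by
  rw [wave_apply, norm_mul, Circle.norm_coe, one_mul]

/-- The radius `1/128` moves each rescaled coordinate by at most `1/16`. Coordinate `i` then stays
within the plateau `(3/4 · 2^j, 2^j]` around `7/8 · 2^j`, and the others stay in `[-1, 1]`, where
only level `0` is active. -/
theorem blockSymbol_add_center (hφ : IsGenerator φ₀) (i : Fin d) {j : ℕ} (hj : 1 ≤ j)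
    (k : Fin d → ℕ) {ζ : EuclideanSpace ℝ (Fin d)} (hζ : ‖ζ‖ ≤ 1 / 128) :
    blockSymbol φ₀ k (ζ + center i j) = if k = Pi.single i j then 1 else 0 := by
  have hcoord : ∀ l, dyadic φ₀ (k l) (((2 * Real.pi) • (ζ + center i j)) l) =
      if k l = (Pi.single i j : Fin d → ℕ) l then 1 else 0 := by
    intro l
    have h2 : |ζ l| ≤ 1 / 128 := (PiLp.norm_apply_le ζ l).trans hζ
    have h3 : |2 * Real.pi * ζ l| ≤ 1 / 16 := by
      rw [abs_mul, abs_of_pos Real.two_pi_pos]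
      nlinarith [abs_nonneg (ζ l), Real.pi_pos, Real.pi_lt_four]
    have h4 : ((2 * Real.pi) • (ζ + center i j)) l =
        2 * Real.pi * ζ l + if l = i then 7 / 8 * 2 ^ j else 0 := by
      rw [← two_pi_mul_center]
      simp only [PiLp.smul_apply, PiLp.add_apply, smul_eq_mul, mul_add]
    have h5 : (2 : ℝ) ^ 1 ≤ 2 ^ j := pow_le_pow_right₀ (by norm_num) hj
    have h6 := abs_le.1 h3
    rw [h4]
    by_cases hl : l = i
    · subst hl
      rw [if_pos rfl, dyadic_of_mem hφ hj (by linarith) (by linarith), Pi.single_eq_same]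
    · rw [if_neg hl, add_zero, dyadic_of_abs_le_one hφ (h3.trans (by norm_num)),
        Pi.single_eq_of_ne hl]
  rw [blockSymbol, dyadicTensor, Finset.prod_congr rfl fun l _ => hcoord l,
    Finset.prod_ite_zero]
  simp only [Finset.mem_univ, true_implies, Finset.prod_const_one, funext_iff]
  split_ifs <;> simp

theorem dyadicBlock_wave (hφ : IsGenerator φ₀) {ψ : 𝓢(EuclideanSpace ℝ (Fin d), ℂ)}
    (hψ : ∀ ζ, ψ ζ ≠ 0 → ‖ζ‖ ≤ 1 / 128) (i : Fin d) {j : ℕ} (hj : 1 ≤ j) (k : Fin d → ℕ) :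
    dyadicBlock φ₀ k
        (SchwartzMap.toTemperedDistributionCLM (EuclideanSpace ℝ (Fin d)) ℂ volume (wave ψ i j)) =
      if k = Pi.single i j then
        SchwartzMap.toTemperedDistributionCLM (EuclideanSpace ℝ (Fin d)) ℂ volume (wave ψ i j)
      else 0 := by
  have hM := hasTemperateGrowth_blockSymbol hφ k
  have key : SchwartzMap.smulLeftCLM ℂ (blockSymbol φ₀ k) (ψ.compSubConstCLM ℂ (center i j)) =
      if k = Pi.single i j then ψ.compSubConstCLM ℂ (center i j) else 0 := by
    ext η
    rw [SchwartzMap.smulLeftCLM_apply_apply hM, SchwartzMap.compSubConstCLM_apply]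
    by_cases h0 : ψ (η - center i j) = 0
    · split_ifs <;> simp [h0]
    · have := blockSymbol_add_center hφ i hj k (hψ _ h0)
      rw [sub_add_cancel] at this
      rw [this]
      split_ifs <;> simp
  rw [dyadicBlock_eq, TemperedDistribution.fourierMultiplierCLM_toTemperedDistributionCLM_eq hM,
    SchwartzMap.fourierMultiplierCLM_apply, wave, FourierTransform.fourier_fourierInv_eq, key]
  split_ifs
  · rfl
  · rw [FourierTransform.fourierInv_zero, map_zero]

theorem besovNorm_wave_le (hφ : IsGenerator φ₀) (p q : ℝ≥0∞) [Fact (1 ≤ p)] (hq : 1 ≤ q) (r : ℝ)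
    {ψ : 𝓢(EuclideanSpace ℝ (Fin d), ℂ)} (hψ : ∀ ζ, ψ ζ ≠ 0 → ‖ζ‖ ≤ 1 / 128)
    (i : Fin d) {j : ℕ} (hj : 1 ≤ j) :
    besovNorm φ₀ p q r
        (SchwartzMap.toTemperedDistributionCLM (EuclideanSpace ℝ (Fin d)) ℂ volume (wave ψ i j)) ≤
      (2 : ℝ≥0∞) ^ (r * j) * ‖(𝓕⁻ ψ).toLp p‖ₑ := by
  refine (besovNorm_le_of_single_block p q hq r (dyadicBlock_wave hφ hψ i hj)).trans ?_
  rw [Finset.sum_pi_single', if_pos (Finset.mem_univ i)]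
  refine mul_le_mul_right ((lpNorm_toTemperedDistributionCLM_le p _).trans_eq ?_) _
  rw [← ofReal_norm, ← ofReal_norm, norm_toLp_congr (norm_wave_apply ψ i j)]

/-! ### Restriction to the cube and test functions there. -/

theorem regularDistribution_apply {f : EuclideanSpace ℝ (Fin d) → ℂ} (hf : Continuous f)
    (φ : 𝓓(openCube d, ℂ)) : regularDistribution f φ = ∫ x, φ x * f x := by
  rw [regularDistribution, TestFunction.integralAgainstBilinCLM_eq_integral
    (hf.locallyIntegrable.locallyIntegrableOn _)]
  rfl

theorem restrictsTo_regularDistribution (f : 𝓢(EuclideanSpace ℝ (Fin d), ℂ)) :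
    RestrictsTo
      (SchwartzMap.toTemperedDistributionCLM (EuclideanSpace ℝ (Fin d)) ℂ volume f)
      (regularDistribution f) := fun φ => by
  rw [regularDistribution_apply f.continuous]
  exact SchwartzMap.toTemperedDistributionCLM_apply_apply volume f _

theorem besovNormCube_le (φ₀ : ℝ → ℝ) (p q : ℝ≥0∞) [Fact (1 ≤ p)] (r : ℝ)
    (f : 𝓢(EuclideanSpace ℝ (Fin d), ℂ)) :
    besovNormCube φ₀ p q r (regularDistribution f) ≤ besovNorm φ₀ p q r
      (SchwartzMap.toTemperedDistributionCLM (EuclideanSpace ℝ (Fin d)) ℂ volume f) := by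
  rw [besovNormCube]
  exact iInf₂_le_of_le _ (restrictsTo_regularDistribution f) le_rfl

theorem exists_narrow_bump (d : ℕ) : ∃ ψ : 𝓢(EuclideanSpace ℝ (Fin d), ℂ),
    (∀ ζ, ψ ζ ≠ 0 → ‖ζ‖ ≤ 1 / 128) ∧ 𝓕⁻ ψ 0 ≠ 0 := by
  let b : ContDiffBump (0 : EuclideanSpace ℝ (Fin d)) :=
    ⟨1 / 256, 1 / 128, by norm_num, by norm_num⟩
  have hcs : HasCompactSupport fun x => (b x : ℂ) :=
    b.hasCompactSupport.comp_left (g := Complex.ofReal) Complex.ofReal_zero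
  have hsm : ContDiff ℝ ((⊤ : ℕ∞) : WithTop ℕ∞) fun x => (b x : ℂ) :=
    Complex.ofRealCLM.contDiff.comp b.contDiff
  refine ⟨hcs.toSchwartzMap hsm, fun ζ hζ => ?_, ?_⟩
  · have h1 : ζ ∈ Function.support b := fun h0 => hζ <| by
      change ((b ζ : ℝ) : ℂ) = 0
      rw [h0, Complex.ofReal_zero]
    rw [b.support_eq, mem_ball_zero_iff] at h1
    exact h1.le
  · rw [SchwartzMap.fourierInv_coe, Real.fourierInv_eq]
    simp only [inner_zero_right, AddChar.map_zero_eq_one, one_smul]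
    change ∫ x, ((b x : ℝ) : ℂ) ≠ 0
    rw [integral_complex_ofReal]
    exact_mod_cast (b.integral_pos (μ := volume)).ne'

/-- Otherwise `f` vanishes on the open cube by the fundamental lemma of the calculus of variations,
hence by continuity at the corner `0`, a limit of the diagonal points `(ε, …, ε)`. -/
theorem exists_testFunction_integral_ne_zero {f : EuclideanSpace ℝ (Fin d) → ℂ}
    (hf : Continuous f) (h0 : f 0 ≠ 0) :
    ∃ η : 𝓓(openCube d, ℂ), ∫ x, η x * f x ≠ 0 := by
  by_contra! hcon
  have hae := (openCube d).isOpen.ae_eq_zero_of_integral_contDiff_smul_eq_zero (μ := volume)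
    (hf.locallyIntegrable.locallyIntegrableOn _) fun g hg hcs hsupp => by
      have hsub : tsupport (fun x => (g x : ℂ)) ⊆ tsupport g :=
        closure_mono fun x hx h => hx (by simp [h])
      have := hcon ⟨fun x => (g x : ℂ), Complex.ofRealCLM.contDiff.comp hg,
        hcs.comp_left (g := Complex.ofReal) Complex.ofReal_zero, hsub.trans hsupp⟩
      simpa [Complex.real_smul] using! this
  have heq : Set.EqOn f (fun _ => 0) (openCube d) :=
    Measure.eqOn_open_of_ae_eq (μ := volume)
      ((ae_restrict_iff' (openCube d).isOpen.measurableSet).2 hae) (openCube d).isOpen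
      hf.continuousOn continuousOn_const
  have hcl : (0 : EuclideanSpace ℝ (Fin d)) ∈ closure (openCube d : Set _) := by
    have ht : Tendsto (fun ε : ℝ => (WithLp.toLp 2 fun _ => ε : EuclideanSpace ℝ (Fin d)))
        (𝓝[>] 0) (𝓝 0) := by
      have hc : Continuous fun ε : ℝ =>
        (WithLp.toLp 2 fun _ => ε : EuclideanSpace ℝ (Fin d)) :=
        (PiLp.continuous_toLp 2 _).comp (continuous_pi fun _ => continuous_id)
      exact (hc.tendsto 0).mono_left nhdsWithin_le_nhds
    refine mem_closure_of_tendsto ht ?_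
    filter_upwards [Ioo_mem_nhdsGT (zero_lt_one' ℝ)] with ε hε
    exact fun _ => hε
  exact h0 ((heq.closure hf continuous_const) hcl)

/-- The test function `x ↦ e^{-2πi ⟪c, x⟫} η x`. -/
theorem exists_modulated_testFunction (η : 𝓓(openCube d, ℂ)) (c : EuclideanSpace ℝ (Fin d)) :
    ∃ h : 𝓓(openCube d, ℂ),
      (∀ x, h x = (Real.fourierChar (-inner ℝ c x) : ℂ) * η x) ∧
      testToSchwartz h = 𝓕 ((𝓕⁻ (testToSchwartz η)).compSubConstCLM ℂ c) := by
  set w := 𝓕 ((𝓕⁻ (testToSchwartz η)).compSubConstCLM ℂ c) with hw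
  have hwx : ∀ x, w x = (Real.fourierChar (-inner ℝ c x) : ℂ) * η x := fun x => by
    rw [hw, fourier_compSubConstCLM_apply, FourierTransform.fourier_fourierInv_eq]
    rfl
  -- Modulation does not enlarge the support, so the result is still a test function on the open
  -- cube.
  have hsupp : tsupport w ⊆ tsupport η := closure_mono fun x hx h => hx (by simp [hwx, h])
  refine ⟨⟨w, w.smooth ⊤, η.hasCompactSupport.of_isClosed_subset (isClosed_tsupport _) hsupp,
    hsupp.trans η.tsupport_subset⟩, hwx, ?_⟩
  ext x
  rfl

theorem memBesovCubeInter_wave (hφ : IsGenerator φ₀) (p q : ℝ≥0∞) [Fact (1 ≤ p)] (hq : 1 ≤ q)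
    (r : ℝ) {ψ : 𝓢(EuclideanSpace ℝ (Fin d), ℂ)} (hψ : ∀ ζ, ψ ζ ≠ 0 → ‖ζ‖ ≤ 1 / 128)
    (i : Fin d) {j : ℕ} (hj : 1 ≤ j) : MemBesovCubeInter φ₀ p q r (wave ψ i j) := by
  refine ⟨((wave ψ i j).memLp ∞ volume).restrict _, _, ?_, restrictsTo_regularDistribution _⟩
  refine (besovNorm_wave_le hφ p q hq r hψ i hj).trans_lt (ENNReal.mul_lt_top ?_ enorm_lt_top)
  exact (ENNReal.rpow_ne_top_of_ne_zero two_ne_zero ENNReal.ofNat_ne_top).lt_top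

theorem eLpNorm_wave_le (ψ : 𝓢(EuclideanSpace ℝ (Fin d), ℂ)) (i : Fin d) (j : ℕ) :
    eLpNorm (wave ψ i j) ∞ (volume.restrict (cube d)) ≤ eLpNorm (𝓕⁻ ψ : 𝓢(EuclideanSpace ℝ (Fin d), ℂ)) ∞ volume :=
  (eLpNorm_restrict_le _ _ _ _).trans_eq
    (eLpNorm_congr_norm_ae (Eventually.of_forall (norm_wave_apply ψ i j)))

/-- The quotient norm of the product of two waves in different directions grows at least like
`2^{3rj/2}`. -/
theorem exists_enorm_le_besovNormCube_mul_wave (hφ : IsGenerator φ₀) {i₀ i₁ : Fin d}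
    (hi : i₀ ≠ i₁) (p q : ℝ≥0∞) [Fact (1 ≤ p)] (hq : 1 ≤ q) {r : ℝ} (hr : 0 < r)
    {ψ : 𝓢(EuclideanSpace ℝ (Fin d), ℂ)} (hψ : 𝓕⁻ ψ 0 ≠ 0) :
    ∃ (a C : ℝ≥0∞), a ≠ 0 ∧ C ≠ ∞ ∧ ∀ j : ℕ,
      a ≤ C * (2 : ℝ≥0∞) ^ (-(3 / 2 * r * j)) * besovNormCube φ₀ p q r
        (regularDistribution fun x => wave ψ i₀ j x * wave ψ i₁ j x) := by
  obtain ⟨η, hη⟩ := exists_testFunction_integral_ne_zero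
    (f := fun x => 𝓕⁻ ψ x * 𝓕⁻ ψ x) ((𝓕⁻ ψ).continuous.mul (𝓕⁻ ψ).continuous)
    (mul_ne_zero hψ hψ)
  obtain ⟨C, hC, hbound⟩ := exists_enorm_apply_le_besovNorm hφ hi p q hq hr
    (𝓕⁻ (testToSchwartz η))
  -- The maximum with `1` keeps the constant nonzero, so that it can be divided out before passing
  -- to the infimum over extensions.
  refine ⟨‖∫ x, η x * (𝓕⁻ ψ x * 𝓕⁻ ψ x)‖ₑ, max C 1, by simpa using hη, by simp [hC],
    fun j => ?_⟩
  obtain ⟨h, hx, hS⟩ := exists_modulated_testFunction η (center i₀ j + center i₁ j)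
  have hc0 : max C 1 * (2 : ℝ≥0∞) ^ (-(3 / 2 * r * j)) ≠ 0 :=
    mul_ne_zero (zero_lt_one.trans_le (le_max_right C 1)).ne'
      (ENNReal.rpow_pos two_pos ENNReal.ofNat_ne_top).ne'
  have hct : max C 1 * (2 : ℝ≥0∞) ^ (-(3 / 2 * r * j)) ≠ ∞ :=
    ENNReal.mul_ne_top (by simp [hC])
      (ENNReal.rpow_ne_top_of_ne_zero two_ne_zero ENNReal.ofNat_ne_top)
  rw [mul_comm, ← ENNReal.div_le_iff hc0 hct, besovNormCube]
  refine le_iInf₂ fun G hG => ?_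
  rw [ENNReal.div_le_iff hc0 hct, mul_comm]
  have hcont : Continuous fun x => wave ψ i₀ j x * wave ψ i₁ j x :=
    (wave ψ i₀ j).continuous.mul (wave ψ i₁ j).continuous
  have hG' : G (testToSchwartz h) = ∫ x, η x * (𝓕⁻ ψ x * 𝓕⁻ ψ x) := by
    rw [hG h, regularDistribution_apply hcont]
    refine integral_congr_ae (Eventually.of_forall fun x => ?_)
    -- The phases of the two waves and of the test function cancel, which makes the pairing
    -- independent of `j`.
    have hphase : (Real.fourierChar (-inner ℝ (center i₀ j + center i₁ j) x) : ℂ) *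
        ((Real.fourierChar (inner ℝ (center i₀ j) x) : ℂ) *
          (Real.fourierChar (inner ℝ (center i₁ j) x) : ℂ)) = 1 := by
      rw [← Circle.coe_mul, ← Circle.coe_mul, ← AddChar.map_add_eq_mul,
        ← AddChar.map_add_eq_mul, inner_add_left, neg_add_cancel, AddChar.map_zero_eq_one,
        Circle.coe_one]
    simp only [hx, wave_apply]
    linear_combination (η x * (𝓕⁻ ψ x * 𝓕⁻ ψ x)) * hphase
  rw [← hG', hS]
  refine (hbound j G).trans ?_
  gcongr
  exact le_max_left _ _

end DominatingMixed

theorem theorem3p13 (d : ℕ) (hd : 1 < d) (p q : ℝ≥0∞) [Fact (1 ≤ p)] (hq : 1 ≤ q)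
    (r : ℝ) (hr : 0 < r) (φ₀ : ℝ → ℝ) (hφ₀ : DominatingMixed.IsGenerator φ₀) :
    ¬ ∃ C : ℝ≥0, 0 < C ∧ ∀ f g : EuclideanSpace ℝ (Fin d) → ℂ,
      DominatingMixed.MemBesovCubeInter φ₀ p q r f →
      DominatingMixed.MemBesovCubeInter φ₀ p q r g →
      DominatingMixed.besovNormCube φ₀ p q r
          (DominatingMixed.regularDistribution fun x => f x * g x) ≤
        C * (DominatingMixed.besovNormCube φ₀ p q r (DominatingMixed.regularDistribution f) *
              eLpNorm g ∞ (volume.restrict (DominatingMixed.cube d)) +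
            eLpNorm f ∞ (volume.restrict (DominatingMixed.cube d)) *
              DominatingMixed.besovNormCube φ₀ p q r
                (DominatingMixed.regularDistribution g)) := by
  open DominatingMixed FourierTransform Filter Topology in
  rintro ⟨C, -, hC⟩
  obtain ⟨ψ, hψ, hψ0⟩ := exists_narrow_bump d
  set i₀ : Fin d := ⟨0, by omega⟩
  set i₁ : Fin d := ⟨1, hd⟩
  have hi : i₀ ≠ i₁ := by simp [i₀, i₁]
  obtain ⟨a, D, ha, hD, hlow⟩ :=
    exists_enorm_le_besovNormCube_mul_wave hφ₀ hi p q hq hr hψ0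
  set A : ℝ≥0∞ := ‖(𝓕⁻ ψ).toLp p (volume : Measure (EuclideanSpace ℝ (Fin d)))‖ₑ with hA
  set S : ℝ≥0∞ := eLpNorm (𝓕⁻ ψ : 𝓢(EuclideanSpace ℝ (Fin d), ℂ)) ∞ (volume : Measure (EuclideanSpace ℝ (Fin d))) with hS
  have hAt : A ≠ ∞ := enorm_ne_top
  have hSt : S ≠ ∞ := ((𝓕⁻ ψ).eLpNorm_lt_top ∞ volume).ne
  have hup : ∀ (i : Fin d) {j : ℕ}, 1 ≤ j →
      besovNormCube φ₀ p q r (regularDistribution (wave ψ i j)) ≤ (2 : ℝ≥0∞) ^ (r * j) * A :=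
    fun i j hj => (besovNormCube_le φ₀ p q r _).trans (besovNorm_wave_le hφ₀ p q hq r hψ i hj)
  set M : ℝ≥0∞ := D * C * (2 * A * S) with hM
  have hMt : M ≠ ∞ := by finiteness
  -- `x ^ j` is the quotient of the upper growth `2^(rj)` by the lower growth `2^(3rj/2)`. The
  -- inequality would keep the positive constant `a` below `M * x ^ j`, which tends to `0`.
  set x : ℝ≥0∞ := (2 : ℝ≥0∞) ^ (-(r / 2)) with hx
  have hx1 : x < 1 := ENNReal.rpow_lt_one_of_one_lt_of_neg (by norm_num) (by linarith)
  have hle : ∀ j : ℕ, 1 ≤ j → a ≤ M * x ^ j := by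
    intro j hj
    have h1 := hC (wave ψ i₀ j) (wave ψ i₁ j) (memBesovCubeInter_wave hφ₀ p q hq r hψ i₀ hj)
      (memBesovCubeInter_wave hφ₀ p q hq r hψ i₁ hj)
    have hpow : (2 : ℝ≥0∞) ^ (-(3 / 2 * r * j)) * (2 : ℝ≥0∞) ^ (r * j) = x ^ j := by
      rw [← ENNReal.rpow_add _ _ two_ne_zero ENNReal.ofNat_ne_top, hx, ← ENNReal.rpow_natCast,
        ← ENNReal.rpow_mul]
      congr 1
      ring
    calc a ≤ D * (2 : ℝ≥0∞) ^ (-(3 / 2 * r * j)) * (C * ((2 : ℝ≥0∞) ^ (r * j) * A * S +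
            S * ((2 : ℝ≥0∞) ^ (r * j) * A))) := by
          refine (hlow j).trans (mul_le_mul_right (h1.trans ?_) _)
          gcongr
          · exact hup i₀ hj
          · exact eLpNorm_wave_le ψ i₁ j
          · exact eLpNorm_wave_le ψ i₀ j
          · exact hup i₁ hj
      _ = M * ((2 : ℝ≥0∞) ^ (-(3 / 2 * r * j)) * (2 : ℝ≥0∞) ^ (r * j)) := by
          rw [hM]; ring
      _ = M * x ^ j := by rw [hpow]
  have hlim : Tendsto (fun j : ℕ => M * x ^ j) atTop (𝓝 0) := by
    simpa using ENNReal.Tendsto.const_mul (ENNReal.tendsto_pow_atTop_nhds_zero_of_lt_one hx1)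
      (Or.inr hMt)
  refine ha (le_antisymm (ge_of_tendsto hlim ?_) zero_le)
  filter_upwards [eventually_ge_atTop 1] with j hj using hle j hj
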